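/- \textbf{Theorem (Quantum Non-uniform Min-Max Theorem).} Let $D(\mathbb{C}^d)$ be the set of $d\times d$ density matrices (positive semidefinite complex matrices of trace one), and let $\langle X,Y\rangle=\operatorname{tr}(X^\dagger Y)$. There is a universal constant $C>0$ such that the following holds for every integer $d\ge 2$. Let the strategy space of Player 1 be an arbitrary set $\mathcal{A}\subseteq D(\mathbb{C}^d)$, let the strategy space of Player 2 be an arbitrary nonempty set $\mathcal{B}$, let $f$ map each $b\in\mathcal{B}$ to a $d\times d$ matrix $f(b)$ with $0\le f(b)\le I_d$, and let the payoff be $g(a,b)=\langle a,f(b)\rangle$ for $a\in\operatorname{Conv}(\mathcal{A})$, $b\in\mathcal{B}$. Let $p\in\mathbb{R}$ and suppose that for every mixed strategy $a\in\operatorname{Conv}(\mathcal{A})$ of Player 1 there is a pure strategy $b\in\mathcal{B}$ of Player 2 with $g(a,b)\ge p$. Then for every $\varepsilon\in(0,1/2)$ there is a mixed strategy $\hat B$ of Player 2 (a probability distribution on $\mathcal{B}$) such that $$\mathbb{E}_{b\leftarrow\hat B}\,[g(a,b)]\ \ge\ p-\varepsilon\qquad\text{for every strategy } a\in\mathcal{A}\text{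 of Player 1}.$$ Moreover, $\hat B$ is the uniform distribution over a nonempty multiset $S$ of at most $C\,\log d/\varepsilon^2$ strategies in $\mathcal{B}$ (counted with multiplicity). -/

import Mathlib

open scoped Matrix ComplexOrder

noncomputable section

namespace QuantumMinMax

/-- The set `D(ℂ^d)` of density matrices: positive semidefinite (hence Hermitian) of trace one. -/
def densityMatrices (d : ℕ) : Set (Matrix (Fin d) (Fin d) ℂ) :=
  {ρ | ρ.PosSemidef ∧ ρ.trace = 1}

/-- The matrices `M` with `0 ≤ M ≤ I` in the Loewner order. -/
def effects (d : ℕ) : Set (Matrix (Fin d) (Fin d) ℂ) :=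
  {M | M.PosSemidef ∧ (1 - M).PosSemidef}

/-- The Hilbert-Schmidt inner product `⟨X, Y⟩ = tr(X† Y)`. -/
def hsInner {d : ℕ} (X Y : Matrix (Fin d) (Fin d) ℂ) : ℂ :=
  (Xᴴ * Y).trace

/-- The payoff `g(a, b) = ⟨a, f(b)⟩` as a real number; see `payoff_eq` for why taking the real
part loses nothing. -/
def payoff {d : ℕ} {B : Type*} (f : B → Matrix (Fin d) (Fin d) ℂ)
    (a : Matrix (Fin d) (Fin d) ℂ) (b : B) : ℝ :=
  (hsInner a (f b)).re

/-- For Hermitian `a` and `f b` the inner product is real. -/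
theorem payoff_eq {d : ℕ} {B : Type*} (f : B → Matrix (Fin d) (Fin d) ℂ)
    (a : Matrix (Fin d) (Fin d) ℂ) (b : B) (ha : a.IsHermitian) (hb : (f b).IsHermitian) :
    (payoff f a b : ℂ) = hsInner a (f b) := by
  unfold payoff
  apply Complex.conj_eq_iff_re.mp
  unfold hsInner
  rw [starRingEnd_apply, ← Matrix.trace_conjTranspose, Matrix.conjTranspose_mul,
    Matrix.conjTranspose_conjTranspose, ha.eq, hb.eq, Matrix.trace_mul_comm]

/-- The expectation `E_{b ← P}[h(b)]` of a bounded real function under a discrete distribution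
(the series converges absolutely). -/
def expectation {B : Type*} (P : PMF B) (h : B → ℝ) : ℝ :=
  ∑' b, (P b).toReal * h b

end QuantumMinMax

end

/-!
The proof derandomizes matrix sampling with the potential `tr exp`.

* Sion's minimax theorem gives a convex combination `F` of the effects `f b` with
  `⟨a, F⟩ > p - ε / 2` for all `a ∈ A` (`exists_mem_convexHull_forall_lt`). Uniform boundedness of
  effects carries the hypothesis, with an arbitrarily small loss, from `Conv A` to its compact
  closure.
* The replies `b₁, …, b_T` are chosen greedily. For the current Hermitian matrix
  `X = η ∑ (F - f bᵢ)` there is a `b` with `tr (e^X (F - f b)) ≤ 0`, because `F` is an average of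
  the `f b`. With that choice `tr e^X` grows by a factor of at most `exp (2 η²)`
  (`traceExp_le_mul`), so that it is at most `d exp (2 η² T)` in the end
  (`exists_multiset_traceExp_le`).
* For a density matrix `a` one has `tr (a Z) ≤ log (tr e^Z)` (`trace_mul_re_le_of_traceExp_le`).
  Hence the average of `⟨a, f bᵢ⟩` is at least `⟨a, F⟩ - log d / (η T) - 2 η`, and `η = ε / 8`,
  `T = ⌈32 log d / ε²⌉` suffices.

The growth bound needs neither the Golden–Thompson inequality nor differentiation of matrix
functions. If `u i`, `v j` are orthonormal eigenbases of Hermitian `X`, `Z` with eigenvalues `l i`,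
`m j`, then a trace such as `tr e^Z - tr e^X - tr (e^X (Z - X))` is the average of the scalar
Bregman remainder `e^m - e^l - (m - l) e^l` with the doubly stochastic weights `|⟨u i, v j⟩|²`. The
remainder is at most `(m - l)² (e^l + e^m) / 2`, and since
`⟨u i, (Z - X) v j⟩ = (m j - l i) ⟨u i, v j⟩`, the weighted sums of `(m j - l i)²` along rows and
columns are bounded by the square of the operator norm of `Z - X`.
-/

open scoped Matrix ComplexOrder

noncomputable section

namespace QuantumMinMax

/-! ### The scalar Bregman remainder of the exponential -/

theorem exp_sub_le_of_nonneg {x : ℝ} (hx : 0 ≤ x) :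
    Real.exp x - 1 - x ≤ x ^ 2 / 2 * (1 + Real.exp x) := by
  let g : ℝ → ℝ := fun x => x ^ 2 / 2 * (1 + Real.exp x) - (Real.exp x - 1 - x)
  have hd : ∀ y, HasDerivAt g
      (y * (1 + Real.exp y) + y ^ 2 / 2 * Real.exp y - (Real.exp y - 1)) y := by
    intro y
    have h1 := ((((hasDerivAt_id y).fun_pow 2).div_const 2).mul
      ((Real.hasDerivAt_exp y).const_add 1)).sub
      (((Real.hasDerivAt_exp y).sub_const 1).sub (hasDerivAt_id y))
    refine h1.congr_deriv ?_
    simp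
  have hm : MonotoneOn g (Set.Ici 0) := by
    refine monotoneOn_of_deriv_nonneg (convex_Ici 0)
      (fun y _ => (hd y).continuousAt.continuousWithinAt)
      (fun y _ => (hd y).differentiableAt.differentiableWithinAt) fun y hy => ?_
    rw [interior_Ici, Set.mem_Ioi] at hy
    rw [(hd y).deriv]
    -- `e^y - 1 ≤ y e^y` is `1 - y ≤ e^(-y)` multiplied by `e^y`.
    have h1 := Real.add_one_le_exp (-y)
    have h2 : Real.exp y * Real.exp (-y) = 1 := by rw [← Real.exp_add]; simp
    have h3 := mul_le_mul_of_nonneg_left h1 (Real.exp_pos y).le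
    nlinarith [Real.exp_pos y, mul_nonneg (sq_nonneg y) (Real.exp_pos y).le]
  have := hm (Set.mem_Ici.2 le_rfl) (Set.mem_Ici.2 hx) hx
  simp only [g] at this
  norm_num at this
  linarith

theorem exp_sub_le_of_nonpos {x : ℝ} (hx : x ≤ 0) :
    Real.exp x - 1 - x ≤ x ^ 2 / 2 * (1 + Real.exp x) := by
  let g : ℝ → ℝ := fun x => x ^ 2 / 2 - (Real.exp x - 1 - x)
  have hd : ∀ y, HasDerivAt g (y - (Real.exp y - 1)) y := by
    intro y
    have h1 := (((hasDerivAt_id y).fun_pow 2).div_const 2).sub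
      (((Real.hasDerivAt_exp y).sub_const 1).sub (hasDerivAt_id y))
    refine h1.congr_deriv ?_
    simp
  have hm : AntitoneOn g Set.univ := by
    refine antitoneOn_of_deriv_nonpos convex_univ
      (fun y _ => (hd y).continuousAt.continuousWithinAt)
      (fun y _ => (hd y).differentiableAt.differentiableWithinAt) fun y _ => ?_
    rw [(hd y).deriv]
    linarith [Real.add_one_le_exp y]
  have := hm (Set.mem_univ x) (Set.mem_univ 0) hx
  simp only [g] at this
  norm_num at this
  nlinarith [mul_nonneg (sq_nonneg x) (Real.exp_pos x).le]

theorem exp_bregman_le (l m : ℝ) :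
    Real.exp m - Real.exp l - (m - l) * Real.exp l ≤
      (m - l) ^ 2 / 2 * (Real.exp l + Real.exp m) := by
  have h : Real.exp (m - l) - 1 - (m - l) ≤ (m - l) ^ 2 / 2 * (1 + Real.exp (m - l)) :=
    (le_total 0 (m - l)).elim exp_sub_le_of_nonneg exp_sub_le_of_nonpos
  have h1 := mul_le_mul_of_nonneg_left h (Real.exp_pos l).le
  have h2 : Real.exp m = Real.exp l * Real.exp (m - l) := by rw [← Real.exp_add]; ring_nf
  rw [h2]
  linarith

/-! ### The trace exponential of a Hermitian matrix -/

variable {n : Type*} [Fintype n]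

/-- The squared moduli of the entries of `Uᴴ V`. For unitary `U`, `V` they form a doubly stochastic
matrix. -/
def overlap (U V : Matrix n n ℂ) (i j : n) : ℝ := Complex.normSq ((Uᴴ * V) i j)

theorem overlap_nonneg (U V : Matrix n n ℂ) (i j : n) : 0 ≤ overlap U V i j :=
  Complex.normSq_nonneg _

variable [DecidableEq n]

/-- `U diag(g) Uᴴ`, the Hermitian matrix with real eigenvalues `g` and eigenvectors the columns
of `U` (when `U` is unitary). -/
def conjDiag (U : Matrix n n ℂ) (g : n → ℝ) : Matrix n n ℂ :=
  U * Matrix.diagonal (fun i => (g i : ℂ)) * Uᴴ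

theorem trace_conjDiag_mul_conjDiag (U V : Matrix n n ℂ) (g h : n → ℝ) :
    (conjDiag U g * conjDiag V h).trace.re = ∑ i, ∑ j, overlap U V i j * (g i * h j) := by
  have h1 : (conjDiag U g * conjDiag V h).trace =
      (Matrix.diagonal (fun i => (g i : ℂ)) * (Uᴴ * V) *
        (Matrix.diagonal (fun i => (h i : ℂ)) * (Uᴴ * V)ᴴ)).trace := by
    unfold conjDiag
    rw [Matrix.conjTranspose_mul, Matrix.conjTranspose_conjTranspose]
    simp only [Matrix.mul_assoc]
    rw [Matrix.trace_mul_comm U]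
    simp only [Matrix.mul_assoc]
  rw [h1, Matrix.trace]
  simp only [Matrix.diag_apply, Matrix.mul_apply (M := Matrix.diagonal _ * (Uᴴ * V)),
    Matrix.diagonal_mul, Matrix.conjTranspose_apply (Uᴴ * V), Complex.re_sum]
  refine Finset.sum_congr rfl fun i _ => Finset.sum_congr rfl fun j _ => ?_
  have : (g i : ℂ) * (Uᴴ * V) i j * ((h j : ℂ) * star ((Uᴴ * V) i j)) =
      ((overlap U V i j * (g i * h j) : ℝ) : ℂ) := by
    have := Complex.mul_conj ((Uᴴ * V) i j)
    rw [starRingEnd_apply] at this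
    push_cast
    rw [overlap, ← this]
    ring
  rw [this, Complex.ofReal_re]

/-- The matrix of eigenvectors of a Hermitian matrix. -/
abbrev eigU {X : Matrix n n ℂ} (hX : X.IsHermitian) : Matrix n n ℂ := hX.eigenvectorUnitary

theorem eigU_conjTranspose_mul {X : Matrix n n ℂ} (hX : X.IsHermitian) :
    (eigU hX)ᴴ * eigU hX = 1 :=
  Unitary.coe_star_mul_self hX.eigenvectorUnitary

theorem eigU_mul_conjTranspose {X : Matrix n n ℂ} (hX : X.IsHermitian) :
    eigU hX * (eigU hX)ᴴ = 1 :=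
  Unitary.coe_mul_star_self hX.eigenvectorUnitary

theorem conjDiag_eigenvalues {X : Matrix n n ℂ} (hX : X.IsHermitian) :
    conjDiag (eigU hX) hX.eigenvalues = X := by
  conv_rhs => rw [hX.spectral_theorem, Unitary.conjStarAlgAut_apply]
  rfl

theorem conjDiag_one {X : Matrix n n ℂ} (hX : X.IsHermitian) :
    conjDiag (eigU hX) (fun _ => 1) = 1 := by
  simp [conjDiag, eigU_mul_conjTranspose]

theorem conjDiag_mul_conjDiag {X : Matrix n n ℂ} (hX : X.IsHermitian) (g h : n → ℝ) :
    conjDiag (eigU hX) g * conjDiag (eigU hX) h = conjDiag (eigU hX) (fun i => g i * h i) := by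
  have hd : Matrix.diagonal (fun i => ((g i * h i : ℝ) : ℂ)) =
      Matrix.diagonal (fun i => (g i : ℂ)) * Matrix.diagonal (fun i => (h i : ℂ)) := by
    simp [Matrix.diagonal_mul_diagonal]
  unfold conjDiag
  rw [hd]
  rw [show ∀ P Q R S T : Matrix n n ℂ, P * Q * R * (P * S * T) = P * Q * (R * P) * S * T by
    intros; simp only [Matrix.mul_assoc], eigU_conjTranspose_mul, Matrix.mul_one,
    Matrix.mul_assoc (eigU hX)]

/-- The exponential `e^X` of a Hermitian matrix, as a function of its eigenvalues. -/
def expHermitian {X : Matrix n n ℂ} (hX : X.IsHermitian) : Matrix n n ℂ :=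
  conjDiag (eigU hX) fun i => Real.exp (hX.eigenvalues i)

/-- The trace `tr e^X` of the exponential of a Hermitian matrix. -/
def traceExp {X : Matrix n n ℂ} (hX : X.IsHermitian) : ℝ :=
  ∑ i, Real.exp (hX.eigenvalues i)

theorem trace_conjDiag {X : Matrix n n ℂ} (hX : X.IsHermitian) (g : n → ℝ) :
    (conjDiag (eigU hX) g).trace.re = ∑ i, g i := by
  rw [conjDiag, Matrix.trace_mul_comm, ← Matrix.mul_assoc, eigU_conjTranspose_mul, Matrix.one_mul]
  simp [Matrix.trace_diagonal]

theorem traceExp_nonneg {X : Matrix n n ℂ} (hX : X.IsHermitian) : 0 ≤ traceExp hX :=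
  Finset.sum_nonneg fun _ _ => (Real.exp_pos _).le

theorem traceExp_zero (h : (0 : Matrix n n ℂ).IsHermitian) :
    traceExp h = Fintype.card n := by
  simp [traceExp, h.eigenvalues_eq_zero_iff.2 rfl]

section TwoMatrices

variable {X Z : Matrix n n ℂ} (hX : X.IsHermitian) (hZ : Z.IsHermitian)

theorem sum_overlap_left (g : n → ℝ) :
    ∑ i, ∑ j, overlap (eigU hX) (eigU hZ) i j * g i = ∑ i, g i := by
  have := trace_conjDiag_mul_conjDiag (eigU hX) (eigU hZ) g (fun _ => 1)
  rw [conjDiag_one, Matrix.mul_one, trace_conjDiag] at this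
  simpa using this.symm

theorem sum_overlap_right (g : n → ℝ) :
    ∑ i, ∑ j, overlap (eigU hX) (eigU hZ) i j * g j = ∑ i, g i := by
  have := trace_conjDiag_mul_conjDiag (eigU hX) (eigU hZ) (fun _ => 1) g
  rw [conjDiag_one, Matrix.one_mul, trace_conjDiag] at this
  simpa using this.symm

/-- The entries of `Z - X` between an eigenbasis of `X` and one of `Z`. -/
theorem conjTranspose_eigU_mul_sub_mul_eigU_apply (i j : n) :
    ((eigU hX)ᴴ * (Z - X) * eigU hZ) i j =
      ((hZ.eigenvalues j - hX.eigenvalues i : ℝ) : ℂ) * ((eigU hX)ᴴ * eigU hZ) i j := by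
  have h1 : (eigU hX)ᴴ * X = Matrix.diagonal (fun i => (hX.eigenvalues i : ℂ)) * (eigU hX)ᴴ := by
    conv_lhs => enter [2]; rw [← conjDiag_eigenvalues hX]
    rw [conjDiag, ← Matrix.mul_assoc, ← Matrix.mul_assoc, eigU_conjTranspose_mul, Matrix.one_mul]
  have h2 : Z * eigU hZ = eigU hZ * Matrix.diagonal (fun i => (hZ.eigenvalues i : ℂ)) := by
    conv_lhs => enter [1]; rw [← conjDiag_eigenvalues hZ]
    rw [conjDiag, Matrix.mul_assoc, eigU_conjTranspose_mul, Matrix.mul_one]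
  rw [Matrix.mul_sub, Matrix.sub_mul, Matrix.mul_assoc _ Z, h2, h1, ← Matrix.mul_assoc,
    Matrix.mul_assoc _ _ (eigU hZ), Matrix.sub_apply, Matrix.mul_diagonal, Matrix.diagonal_mul]
  push_cast
  ring

theorem normSq_conjTranspose_eigU_mul_sub_mul_eigU (i j : n) :
    Complex.normSq (((eigU hX)ᴴ * (Z - X) * eigU hZ) i j) =
      overlap (eigU hX) (eigU hZ) i j * (hZ.eigenvalues j - hX.eigenvalues i) ^ 2 := by
  rw [conjTranspose_eigU_mul_sub_mul_eigU_apply, Complex.normSq_mul, Complex.normSq_ofReal,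
    overlap]
  ring

/-- A matrix `G` with `G Gᴴ ≤ c` has rows of squared norm at most `c`. -/
theorem sum_normSq_row_le {G : Matrix n n ℂ} {c : ℝ}
    (h : ((c : ℂ) • (1 : Matrix n n ℂ) - G * Gᴴ).PosSemidef) (i : n) :
    ∑ j, Complex.normSq (G i j) ≤ c := by
  have h1 := (Complex.le_def.1 (h.diag_nonneg (i := i))).1
  have h2 : ((G * Gᴴ) i i).re = ∑ j, Complex.normSq (G i j) := by
    simp [Matrix.mul_apply, Complex.normSq_apply]
  simp only [Matrix.sub_apply, Complex.sub_re, h2] at h1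
  simpa using h1

variable {hX hZ} in
theorem sum_overlap_mul_sq_row_le {c : ℝ}
    (h : ((c : ℂ) • (1 : Matrix n n ℂ) - (Z - X) * (Z - X)).PosSemidef) (i : n) :
    ∑ j, overlap (eigU hX) (eigU hZ) i j * (hZ.eigenvalues j - hX.eigenvalues i) ^ 2 ≤ c := by
  simp only [← normSq_conjTranspose_eigU_mul_sub_mul_eigU]
  refine sum_normSq_row_le ?_ i
  have h1 := h.conjTranspose_mul_mul_same (eigU hX)
  convert h1 using 1
  rw [Matrix.conjTranspose_mul, Matrix.conjTranspose_mul, Matrix.conjTranspose_conjTranspose,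
    (hZ.sub hX).eq, Matrix.mul_sub _ (_ • _), Matrix.sub_mul (_ * _ • _)]
  congr 1
  · simp [eigU_conjTranspose_mul]
  · rw [show ∀ P Q R S T : Matrix n n ℂ, P * Q * R * (S * (Q * T)) = P * Q * (R * S) * Q * T by
      intros; simp only [Matrix.mul_assoc], eigU_mul_conjTranspose, Matrix.mul_one]
    simp only [Matrix.mul_assoc]

variable {hX hZ} in
theorem sum_overlap_mul_sq_col_le {c : ℝ}
    (h : ((c : ℂ) • (1 : Matrix n n ℂ) - (Z - X) * (Z - X)).PosSemidef) (j : n) :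
    ∑ i, overlap (eigU hX) (eigU hZ) i j * (hZ.eigenvalues j - hX.eigenvalues i) ^ 2 ≤ c := by
  have h' : ((c : ℂ) • (1 : Matrix n n ℂ) - (X - Z) * (X - Z)).PosSemidef := by
    rwa [show (X - Z) * (X - Z) = (Z - X) * (Z - X) by noncomm_ring]
  refine le_of_eq_of_le (Finset.sum_congr rfl fun i _ => ?_)
    (sum_overlap_mul_sq_row_le (hX := hZ) (hZ := hX) h' j)
  have : (eigU hX)ᴴ * eigU hZ = ((eigU hZ)ᴴ * eigU hX)ᴴ := by
    rw [Matrix.conjTranspose_mul, Matrix.conjTranspose_conjTranspose]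
  rw [overlap, overlap, this, Matrix.conjTranspose_apply, ← starRingEnd_apply, Complex.normSq_conj]
  ring

/-- Second-order upper bound for `tr exp`; the hypothesis says that `Z - X` has operator norm at
most `√c`. -/
theorem traceExp_le_add {c : ℝ}
    (h : ((c : ℂ) • (1 : Matrix n n ℂ) - (Z - X) * (Z - X)).PosSemidef) :
    traceExp hZ ≤ traceExp hX + (expHermitian hX * (Z - X)).trace.re +
      c / 2 * (traceExp hX + traceExp hZ) := by
  set w := overlap (eigU hX) (eigU hZ) with hw
  set l := hX.eigenvalues with hl
  set m := hZ.eigenvalues with hm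
  have hlin : (expHermitian hX * (Z - X)).trace.re =
      ∑ i, ∑ j, w i j * ((m j - l i) * Real.exp (l i)) := by
    have h1 : (expHermitian hX * Z).trace.re = ∑ i, ∑ j, w i j * (Real.exp (l i) * m j) := by
      have := trace_conjDiag_mul_conjDiag (eigU hX) (eigU hZ) (fun i => Real.exp (l i)) m
      rwa [hm, conjDiag_eigenvalues] at this
    have h2 : (expHermitian hX * X).trace.re = ∑ i, ∑ j, w i j * (Real.exp (l i) * l i) := by
      rw [hw, sum_overlap_left hX hZ (fun i => Real.exp (l i) * l i), ← trace_conjDiag hX,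
        ← conjDiag_mul_conjDiag, hl, conjDiag_eigenvalues]
      rfl
    rw [Matrix.mul_sub, Matrix.trace_sub, Complex.sub_re, h1, h2, ← Finset.sum_sub_distrib]
    refine Finset.sum_congr rfl fun i _ => ?_
    rw [← Finset.sum_sub_distrib]
    exact Finset.sum_congr rfl fun j _ => by ring
  have hX' : traceExp hX = ∑ i, ∑ j, w i j * Real.exp (l i) :=
    (sum_overlap_left hX hZ fun i => Real.exp (l i)).symm
  have hZ' : traceExp hZ = ∑ i, ∑ j, w i j * Real.exp (m j) :=
    (sum_overlap_right hX hZ fun j => Real.exp (m j)).symm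
  have hrow : ∑ i, ∑ j, w i j * (m j - l i) ^ 2 * Real.exp (l i) ≤ c * traceExp hX := by
    rw [traceExp, Finset.mul_sum]
    refine Finset.sum_le_sum fun i _ => ?_
    rw [← Finset.sum_mul]
    exact mul_le_mul_of_nonneg_right (sum_overlap_mul_sq_row_le h i) (Real.exp_pos _).le
  have hcol : ∑ i, ∑ j, w i j * (m j - l i) ^ 2 * Real.exp (m j) ≤ c * traceExp hZ := by
    rw [Finset.sum_comm, traceExp, Finset.mul_sum]
    refine Finset.sum_le_sum fun j _ => ?_
    rw [← Finset.sum_mul]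
    exact mul_le_mul_of_nonneg_right (sum_overlap_mul_sq_col_le h j) (Real.exp_pos _).le
  have hpt : ∑ i, ∑ j, w i j * Real.exp (m j) ≤
      ∑ i, ∑ j, (w i j * Real.exp (l i) + w i j * ((m j - l i) * Real.exp (l i)) +
        (w i j * (m j - l i) ^ 2 * Real.exp (l i) +
          w i j * (m j - l i) ^ 2 * Real.exp (m j)) / 2) := by
    refine Finset.sum_le_sum fun i _ => Finset.sum_le_sum fun j _ => ?_
    have := mul_le_mul_of_nonneg_left (exp_bregman_le (l i) (m j)) (overlap_nonneg (eigU hX) (eigU hZ) i j)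
    rw [← hw] at this
    linarith
  simp only [Finset.sum_add_distrib, ← Finset.sum_div] at hpt
  rw [← hZ', ← hX', ← hlin] at hpt
  linarith

/-- A step of norm at most `η ≤ 1` that does not increase `tr exp` to first order increases it by a
factor of at most `exp (2 η²)`. -/
theorem traceExp_le_mul {η : ℝ} (hη0 : 0 ≤ η) (hη : η ≤ 1)
    (h : (((η ^ 2 : ℝ) : ℂ) • (1 : Matrix n n ℂ) - (Z - X) * (Z - X)).PosSemidef)
    (hlin : (expHermitian hX * (Z - X)).trace.re ≤ 0) :
    traceExp hZ ≤ traceExp hX * Real.exp (2 * η ^ 2) := by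
  have h1 := traceExp_le_add hX hZ h
  set x := η ^ 2 / 2 with hx
  have hx0 : 0 ≤ x := by positivity
  have hx1 : x ≤ 1 / 2 := by rw [hx]; nlinarith
  have h2 : traceExp hZ * (1 - x) ≤ traceExp hX * (1 + x) := by linarith
  have h3 : 1 + x ≤ Real.exp (2 * η ^ 2) * (1 - x) := by
    have := Real.add_one_le_exp (2 * η ^ 2)
    have h4 : 2 * η ^ 2 = 4 * x := by rw [hx]; ring
    rw [h4] at this ⊢
    nlinarith
  have h5 := mul_le_mul_of_nonneg_left h3 (traceExp_nonneg hX)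
  refine le_of_mul_le_mul_right (h2.trans ?_) (by linarith : 0 < 1 - x)
  linarith

end TwoMatrices

/-- A density matrix averages `Z` to at most its largest eigenvalue, which is at most the logarithm
of `tr e^Z`. -/
theorem trace_mul_re_le_of_traceExp_le {a Z : Matrix n n ℂ} (ha : a.PosSemidef)
    (ha1 : a.trace = 1) (hZ : Z.IsHermitian) {L : ℝ} (hL : traceExp hZ ≤ Real.exp L) :
    (a * Z).trace.re ≤ L := by
  have hle : ∀ i, hZ.eigenvalues i ≤ L := fun i => Real.exp_le_exp.1 <|
    (Finset.single_le_sum (f := fun i => Real.exp (hZ.eigenvalues i))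
      (fun _ _ => (Real.exp_pos _).le) (Finset.mem_univ i)).trans hL
  set q := (eigU hZ)ᴴ * a * eigU hZ with hq
  have hq0 : ∀ i, 0 ≤ (q i i).re := fun i =>
    (Complex.le_def.1 ((ha.conjTranspose_mul_mul_same (eigU hZ)).diag_nonneg (i := i))).1
  have hq1 : ∑ i, (q i i).re = 1 := by
    have : q.trace = 1 := by
      rw [hq, Matrix.mul_assoc, Matrix.trace_mul_comm, Matrix.mul_assoc, eigU_mul_conjTranspose,
        Matrix.mul_one, ha1]
    have := congrArg Complex.re this
    simpa [Matrix.trace] using this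
  have htr : (a * Z).trace.re = ∑ i, (q i i).re * hZ.eigenvalues i := by
    have : (a * Z).trace = (q * Matrix.diagonal fun i => (hZ.eigenvalues i : ℂ)).trace := by
      conv_lhs => rw [← conjDiag_eigenvalues hZ]
      rw [conjDiag, hq, ← Matrix.mul_assoc, Matrix.trace_mul_comm]
      simp only [Matrix.mul_assoc]
    rw [this, Matrix.trace]
    simp [Matrix.mul_diagonal]
  calc (a * Z).trace.re = ∑ i, (q i i).re * hZ.eigenvalues i := htr
    _ ≤ ∑ i, (q i i).re * L :=
      Finset.sum_le_sum fun i _ => mul_le_mul_of_nonneg_left (hle i) (hq0 i)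
    _ = L := by rw [← Finset.sum_mul, hq1, one_mul]

/-! ### Bounds on effects and density matrices -/

/-- If `-1 ≤ D ≤ 1` then `D² ≤ 1`: the matrix `1 - D²` is half the sum of `(1 + D) (1 - D) (1 + D)`
and `(1 - D) (1 + D) (1 - D)`. -/
theorem posSemidef_one_sub_mul_self {D : Matrix n n ℂ} (h1 : (1 - D).PosSemidef)
    (h2 : (1 + D).PosSemidef) : (1 - D * D).PosSemidef := by
  have h3 := h1.conjTranspose_mul_mul_same (1 + D)
  have h4 := h2.conjTranspose_mul_mul_same (1 - D)
  rw [h2.1.eq] at h3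
  rw [h1.1.eq] at h4
  have h5 := (h3.add h4).smul (show (0 : ℂ) ≤ 1 / 2 by
    rw [show (1 / 2 : ℂ) = ((1 / 2 : ℝ) : ℂ) by norm_num]
    exact_mod_cast (by norm_num : (0 : ℝ) ≤ 1 / 2))
  convert h5 using 1
  have : (1 + D) * (1 - D) * (1 + D) + (1 - D) * (1 + D) * (1 - D) = (2 : ℂ) • (1 - D * D) := by
    rw [two_smul]
    noncomm_ring
  rw [this, smul_smul]
  norm_num

theorem convex_effects (d : ℕ) : Convex ℝ (effects d) := by
  intro x hx y hy s t hs ht hst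
  have hs' : (0 : ℂ) ≤ s := by exact_mod_cast hs
  have ht' : (0 : ℂ) ≤ t := by exact_mod_cast ht
  have e : ∀ (r : ℝ) (M : Matrix (Fin d) (Fin d) ℂ), r • M = (r : ℂ) • M := fun r M => by
    ext i j; simp
  refine ⟨?_, ?_⟩
  · rw [e, e]
    exact (hx.1.smul hs').add (hy.1.smul ht')
  · have := (hx.2.smul hs').add (hy.2.smul ht')
    convert this using 1
    rw [e, e, smul_sub, smul_sub, sub_add_sub_comm, ← add_smul, ← Complex.ofReal_add, hst]
    simp

theorem norm_apply_le_one_of_mem_effects {d : ℕ} {M : Matrix (Fin d) (Fin d) ℂ}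
    (hM : M ∈ effects d) (i j : Fin d) : ‖M i j‖ ≤ 1 := by
  have h := posSemidef_one_sub_mul_self hM.2 (Matrix.PosSemidef.one.add hM.1)
  have h1 : ∑ j, Complex.normSq (M i j) ≤ 1 := by
    refine sum_normSq_row_le ?_ i
    rw [hM.1.1.eq]
    simpa using h
  have h2 : Complex.normSq (M i j) ≤ 1 :=
    (Finset.single_le_sum (f := fun j => Complex.normSq (M i j))
      (fun _ _ => Complex.normSq_nonneg _) (Finset.mem_univ j)).trans h1
  rw [Complex.normSq_eq_norm_sq] at h2
  exact (sq_le_one_iff₀ (norm_nonneg _)).1 h2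

open scoped MatrixOrder Matrix.Norms.L2Operator in
theorem norm_apply_le_of_mem_densityMatrices {d : ℕ} {a : Matrix (Fin d) (Fin d) ℂ}
    (ha : a ∈ densityMatrices d) (i j : Fin d) : ‖a i j‖ ≤ d := by
  obtain ⟨s, hs⟩ : ∃ s, a = sᴴ * s := CStarAlgebra.nonneg_iff_eq_star_mul_self.1 ha.1.nonneg
  have h1 : ∑ i, ∑ k, Complex.normSq (s k i) = 1 := by
    have := congrArg Complex.re ha.2
    rw [hs] at this
    simpa [Matrix.trace, Matrix.mul_apply, Complex.normSq_apply] using this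
  have h2 : ∀ k i, ‖s k i‖ ≤ 1 := by
    intro k i
    have h3 : Complex.normSq (s k i) ≤ 1 := by
      rw [← h1]
      exact (Finset.single_le_sum (f := fun k => Complex.normSq (s k i))
        (fun _ _ => Complex.normSq_nonneg _) (Finset.mem_univ k)).trans
        (Finset.single_le_sum (f := fun i => ∑ k, Complex.normSq (s k i))
        (fun _ _ => Finset.sum_nonneg fun _ _ => Complex.normSq_nonneg _) (Finset.mem_univ i))
    rw [Complex.normSq_eq_norm_sq] at h3
    exact (sq_le_one_iff₀ (norm_nonneg _)).1 h3
  rw [hs, Matrix.mul_apply]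
  refine (norm_sum_le _ _).trans ((Finset.sum_le_card_nsmul _ _ 1 fun k _ => ?_).trans ?_)
  · rw [norm_mul, Matrix.conjTranspose_apply, norm_star]
    exact mul_le_one₀ (h2 k i) (norm_nonneg _) (h2 k j)
  · simp

/-! ### A convex combination that is good against all strategies -/

theorem hsInner_re_smul_add_left {d : ℕ} (s t : ℝ) (x y F : Matrix (Fin d) (Fin d) ℂ) :
    (hsInner (s • x + t • y) F).re = s * (hsInner x F).re + t * (hsInner y F).re := by
  simp [hsInner, Matrix.conjTranspose_add, Matrix.conjTranspose_smul, Matrix.add_mul,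
    Matrix.trace_add, Matrix.trace_smul]

theorem hsInner_re_smul_add_right {d : ℕ} (s t : ℝ) (a x y : Matrix (Fin d) (Fin d) ℂ) :
    (hsInner a (s • x + t • y)).re = s * (hsInner a x).re + t * (hsInner a y).re := by
  simp [hsInner, Matrix.mul_add, Matrix.trace_add, Matrix.trace_smul]

theorem hsInner_re_sub_le {d : ℕ} (a x : Matrix (Fin d) (Fin d) ℂ)
    {M : Matrix (Fin d) (Fin d) ℂ} (hM : M ∈ effects d) :
    (hsInner a M).re - (hsInner x M).re ≤ ∑ i, ∑ j, ‖a j i - x j i‖ := by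
  rw [← Complex.sub_re, hsInner, hsInner, ← Matrix.trace_sub, ← Matrix.sub_mul,
    ← Matrix.conjTranspose_sub]
  refine (Complex.re_le_norm _).trans ((norm_sum_le _ _).trans
    (Finset.sum_le_sum fun i _ => ?_))
  rw [Matrix.diag_apply, Matrix.mul_apply]
  refine (norm_sum_le _ _).trans (Finset.sum_le_sum fun j _ => ?_)
  rw [norm_mul, Matrix.conjTranspose_apply, norm_star, Matrix.sub_apply]
  exact mul_le_of_le_one_right (norm_nonneg _) (norm_apply_le_one_of_mem_effects hM j i)

theorem isCompact_closure_convexHull {d : ℕ} {A : Set (Matrix (Fin d) (Fin d) ℂ)}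
    (hA : A ⊆ densityMatrices d) : IsCompact (closure (convexHull ℝ A)) := by
  let K : Set (Matrix (Fin d) (Fin d) ℂ) :=
    Set.univ.pi fun _ => Set.univ.pi fun _ => Metric.closedBall (0 : ℂ) d
  have hK : IsCompact K :=
    isCompact_univ_pi fun _ => isCompact_univ_pi fun _ => isCompact_closedBall 0 (d : ℝ)
  have hKc : Convex ℝ K :=
    convex_pi fun _ _ => convex_pi fun _ _ => convex_closedBall (0 : ℂ) (d : ℝ)
  refine hK.closure_of_subset (convexHull_min (fun a ha => ?_) hKc)
  intro i _ j _
  simpa using norm_apply_le_of_mem_densityMatrices (hA ha) i j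

/-- The minimax step: if every mixed strategy of the first player has a pure reply of value at
least `p`, then some mixed reply has value more than `p - δ` against all strategies at once. -/
theorem exists_mem_convexHull_forall_lt {d : ℕ} {A : Set (Matrix (Fin d) (Fin d) ℂ)}
    (hA : A ⊆ densityMatrices d) {B : Type*} [Nonempty B] (f : B → Matrix (Fin d) (Fin d) ℂ)
    (hf : ∀ b, f b ∈ effects d) {p : ℝ} (hp : ∀ a ∈ convexHull ℝ A, ∃ b, p ≤ payoff f a b)
    {δ : ℝ} (hδ : 0 < δ) :
    ∃ F ∈ convexHull ℝ (Set.range f), ∀ a ∈ A, p - δ < (hsInner a F).re := by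
  classical
  obtain rfl | hne := A.eq_empty_or_nonempty
  · obtain ⟨b⟩ := ‹Nonempty B›
    exact ⟨f b, subset_convexHull ℝ _ ⟨b, rfl⟩, by simp⟩
  have hcl : ∀ F : Matrix (Fin d) (Fin d) ℂ,
      Continuous fun x : Matrix (Fin d) (Fin d) ℂ => (hsInner x F).re := fun F =>
    Complex.continuous_re.comp
      (((continuous_id.matrix_conjTranspose).matrix_mul continuous_const).matrix_trace)
  have hcr : ∀ a : Matrix (Fin d) (Fin d) ℂ,
      Continuous fun x : Matrix (Fin d) (Fin d) ℂ => (hsInner a x).re := fun a =>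
    Complex.continuous_re.comp ((continuous_const.matrix_mul continuous_id).matrix_trace)
  set X := closure (convexHull ℝ A) with hXdef
  have hXc : IsCompact X := isCompact_closure_convexHull hA
  have hXne : X.Nonempty := (hne.convexHull (𝕜 := ℝ)).closure
  have hXcv : Convex ℝ X := (convex_convexHull ℝ A).closure
  have hcover : X ⊆ ⋃ b, {x | p - δ < (hsInner x (f b)).re} := by
    intro x hx
    have hopen : IsOpen {a : Matrix (Fin d) (Fin d) ℂ | ∑ i, ∑ j, ‖a j i - x j i‖ < δ} := by
      refine isOpen_lt ?_ continuous_const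
      exact continuous_finsetSum _ fun i _ => continuous_finsetSum _ fun j _ =>
        ((continuous_id.matrix_elem j i).sub continuous_const).norm
    -- A pure reply that is good against a nearby `a ∈ Conv A` stays good against `x`.
    obtain ⟨a, ha, haA⟩ := mem_closure_iff.1 hx _ hopen (by simpa using hδ)
    obtain ⟨b, hb⟩ := hp a haA
    refine Set.mem_iUnion.2 ⟨b, ?_⟩
    have h1 := hsInner_re_sub_le a x (hf b)
    have h2 : ∑ i, ∑ j, ‖a j i - x j i‖ < δ := ha
    rw [payoff] at hb
    show p - δ < _
    linarith
  obtain ⟨t, ht⟩ := hXc.elim_finite_subcover _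
    (fun b => isOpen_lt continuous_const (hcl (f b))) hcover
  have hlinl : ∀ F : Matrix (Fin d) (Fin d) ℂ,
      QuasiconvexOn ℝ X fun x => (hsInner x F).re := fun F =>
    ConvexOn.quasiconvexOn ⟨hXcv, fun x _ y _ s t _ _ _ => by
      simp only [hsInner_re_smul_add_left, smul_eq_mul, le_refl]⟩
  have hlinr : ∀ a : Matrix (Fin d) (Fin d) ℂ,
      QuasiconcaveOn ℝ (convexHull ℝ (Set.range f)) fun y => (hsInner a y).re := fun a =>
    ConcaveOn.quasiconcaveOn ⟨convex_convexHull ℝ _, fun x _ y _ s t _ _ _ => by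
      simp only [hsInner_re_smul_add_right, smul_eq_mul, le_refl]⟩
  obtain ⟨F, hF, hFX⟩ := Sion.exists_lt_iInf_of_lt_iInf_of_finite
    (X := X) (Y := convexHull ℝ (Set.range f)) (f := fun x y => (hsInner x y).re) hXne hXc
    (fun y _ => (hcl y).lowerSemicontinuous.lowerSemicontinuousOn _) (fun y _ => hlinl y)
    (convex_convexHull ℝ _)
    (fun x _ => (hcr x).upperSemicontinuous.upperSemicontinuousOn _) (fun x _ => hlinr x)
    hXcv (s := f '' t) (t.finite_toSet.image f)
    ((Set.image_subset_range f t).trans (subset_convexHull ℝ _)) (t := p - δ)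
    (fun x hx => by
      obtain ⟨b, hb, hxb⟩ := Set.mem_iUnion₂.1 (ht hx)
      exact ⟨f b, ⟨b, hb, rfl⟩, hxb⟩)
  exact ⟨F, hF, fun a ha => hFX a (subset_closure (subset_convexHull ℝ A ha))⟩

/-! ### Greedy choice of the multiset -/

/-- Some member of a family does at least as well as a given convex combination against a linear
functional. -/
theorem exists_trace_mul_sub_re_nonpos {B : Type*} {f : B → Matrix n n ℂ}
    {F : Matrix n n ℂ} (hF : F ∈ convexHull ℝ (Set.range f)) (E : Matrix n n ℂ) :
    ∃ b, (E * (F - f b)).trace.re ≤ 0 := by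
  by_contra! hcon
  have hconv : Convex ℝ {M : Matrix n n ℂ | (E * M).trace.re < (E * F).trace.re} := by
    intro x hx y hy s t hs ht hst
    have hx' : (E * x).trace.re < (E * F).trace.re := hx
    have hy' : (E * y).trace.re < (E * F).trace.re := hy
    show (E * (s • x + t • y)).trace.re < _
    have : (E * (s • x + t • y)).trace.re = s * (E * x).trace.re + t * (E * y).trace.re := by
      simp [Matrix.mul_add, Matrix.trace_add, Matrix.trace_smul]
    rw [this]
    exact (convex_Iio (𝕜 := ℝ) (E * F).trace.re) hx' hy' hs ht hst
  have hsub : Set.range f ⊆ {M : Matrix n n ℂ | (E * M).trace.re < (E * F).trace.re} := by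
    rintro _ ⟨b, rfl⟩
    have := hcon b
    rw [Matrix.mul_sub, Matrix.trace_sub, Complex.sub_re] at this
    show (E * f b).trace.re < _
    linarith
  exact lt_irrefl (E * F).trace.re (convexHull_min hsub hconv hF)

/-- The difference of two effects, scaled by `η`, has operator norm at most `|η|`. -/
theorem posSemidef_sq_smul_one_sub {d : ℕ} {F M : Matrix (Fin d) (Fin d) ℂ} (hF : F ∈ effects d)
    (hM : M ∈ effects d) (η : ℝ) :
    (((η ^ 2 : ℝ) : ℂ) • (1 : Matrix (Fin d) (Fin d) ℂ) -
      ((η : ℂ) • (F - M)) * ((η : ℂ) • (F - M))).PosSemidef := by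
  have h := posSemidef_one_sub_mul_self (D := F - M)
    (by convert hF.2.add hM.1 using 1; abel) (by convert hF.1.add hM.2 using 1; abel)
  have h2 : (0 : ℂ) ≤ ((η ^ 2 : ℝ) : ℂ) := by exact_mod_cast sq_nonneg η
  convert h.smul h2 using 1
  rw [smul_sub _ 1, Matrix.smul_mul, Matrix.mul_smul, smul_smul]
  congr 2
  push_cast
  ring

/-- For every `T` there are `T` elements of the family whose deviation from the convex combination
`F`, scaled by `η`, has trace exponential at most `d exp (2 η² T)`. -/
theorem exists_multiset_traceExp_le {d : ℕ} {B : Type*} {f : B → Matrix (Fin d) (Fin d) ℂ}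
    (hf : ∀ b, f b ∈ effects d) {F : Matrix (Fin d) (Fin d) ℂ}
    (hF : F ∈ convexHull ℝ (Set.range f)) {η : ℝ} (hη0 : 0 ≤ η) (hη : η ≤ 1) (T : ℕ) :
    ∃ S : Multiset B, S.card = T ∧
      ∃ h : ((η : ℂ) • (S.map fun b => F - f b).sum).IsHermitian,
        traceExp h ≤ d * Real.exp (T * (2 * η ^ 2)) := by
  have hFe : F ∈ effects d :=
    convexHull_min (by rintro _ ⟨b, rfl⟩; exact hf b) (convex_effects d) hF
  induction T with
  | zero =>
    refine ⟨0, rfl, by simp, ?_⟩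
    simp [traceExp_zero]
  | succ T ih =>
    obtain ⟨S, hS, h, hle⟩ := ih
    obtain ⟨b, hb⟩ := exists_trace_mul_sub_re_nonpos hF (expHermitian h)
    have hstep : (η : ℂ) • ((b ::ₘ S).map fun b => F - f b).sum -
        (η : ℂ) • (S.map fun b => F - f b).sum = (η : ℂ) • (F - f b) := by
      rw [Multiset.map_cons, Multiset.sum_cons, smul_add, add_sub_cancel_right]
    have hherm : ((η : ℂ) • (F - f b)).IsHermitian := by
      rw [Matrix.IsHermitian, Matrix.conjTranspose_smul, (hFe.1.1.sub (hf b).1.1).eq]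
      simp
    have h' : ((η : ℂ) • ((b ::ₘ S).map fun b => F - f b).sum).IsHermitian := by
      rw [sub_eq_iff_eq_add.1 hstep]
      exact hherm.add h
    refine ⟨b ::ₘ S, by simp [hS], h', ?_⟩
    have hmul := traceExp_le_mul h h' hη0 hη
      (by rw [hstep]; exact posSemidef_sq_smul_one_sub hFe (hf b) η)
      (by
        rw [hstep, Matrix.mul_smul, Matrix.trace_smul, smul_eq_mul, Complex.re_ofReal_mul]
        exact mul_nonpos_of_nonneg_of_nonpos hη0 hb)
    refine hmul.trans ((mul_le_mul_of_nonneg_right hle (Real.exp_pos _).le).trans_eq ?_)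
    rw [mul_assoc, ← Real.exp_add]
    push_cast
    ring_nf

/-- `T` suitable pure strategies have, against every density matrix, an average payoff at least
that of the convex combination `F` minus `log d / (η T) + 2 η`, stated here without division. -/
theorem exists_multiset_average_le {d : ℕ} (hd : 0 < d) {B : Type*}
    {f : B → Matrix (Fin d) (Fin d) ℂ} (hf : ∀ b, f b ∈ effects d)
    {F : Matrix (Fin d) (Fin d) ℂ} (hF : F ∈ convexHull ℝ (Set.range f)) {η : ℝ} (hη0 : 0 ≤ η)
    (hη : η ≤ 1) (T : ℕ) :
    ∃ S : Multiset B, S.card = T ∧ ∀ a ∈ densityMatrices d,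
      η * (T * (hsInner a F).re - (S.map (payoff f a)).sum) ≤
        Real.log d + T * (2 * η ^ 2) := by
  obtain ⟨S, hS, h, hle⟩ := exists_multiset_traceExp_le hf hF hη0 hη T
  refine ⟨S, hS, fun a ha => ?_⟩
  have h1 := trace_mul_re_le_of_traceExp_le ha.1 ha.2 h (L := Real.log d + T * (2 * η ^ 2)) (by
    rwa [Real.exp_add, Real.exp_log (by exact_mod_cast hd)])
  refine le_of_eq_of_le ?_ h1
  rw [Matrix.mul_smul, Matrix.trace_smul, smul_eq_mul, Complex.re_ofReal_mul, ← hS]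
  congr 1
  clear h1 hle h hS
  induction S using Multiset.induction_on with
  | empty => simp
  | cons b S ih =>
    have hb : payoff f a b = (a * f b).trace.re := by rw [payoff, hsInner, ha.1.1.eq]
    have hFa : (hsInner a F).re = (a * F).trace.re := by rw [hsInner, ha.1.1.eq]
    rw [Multiset.map_cons, Multiset.sum_cons, Multiset.map_cons, Multiset.sum_cons,
      Matrix.mul_add, Matrix.trace_add, Complex.add_re, ← ih, Matrix.mul_sub, Matrix.trace_sub,
      Complex.sub_re, Multiset.card_cons, hb, hFa]
    push_cast
    ring

/-! ### Uniform distributions over multisets -/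

theorem expectation_ofMultiset {B : Type*} (S : Multiset B) (hS : S ≠ 0) (h : B → ℝ) :
    expectation (PMF.ofMultiset S hS) h = (S.map h).sum / S.card := by
  classical
  unfold expectation
  rw [tsum_eq_sum (s := S.toFinset), Finset.sum_multiset_map_count, Finset.sum_div]
  · refine Finset.sum_congr rfl fun b _ => ?_
    rw [PMF.ofMultiset_apply, ENNReal.toReal_div, ENNReal.toReal_natCast, ENNReal.toReal_natCast,
      nsmul_eq_mul, div_mul_eq_mul_div]
  · intro b hb
    rw [PMF.ofMultiset_apply_of_notMem hS (by simpa using hb)]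
    simp

end QuantumMinMax

end

theorem mainTheorem5 :
    ∃ C : ℝ, 0 < C ∧
      ∀ (d : ℕ), 2 ≤ d →
      ∀ (A : Set (Matrix (Fin d) (Fin d) ℂ)), A ⊆ QuantumMinMax.densityMatrices d →
      ∀ (B : Type*) [Nonempty B] (f : B → Matrix (Fin d) (Fin d) ℂ),
        (∀ b : B, f b ∈ QuantumMinMax.effects d) →
      ∀ (p : ℝ),
        (∀ a ∈ convexHull ℝ A, ∃ b : B, p ≤ QuantumMinMax.payoff f a b) →
      ∀ (ε : ℝ), 0 < ε → ε < 1 / 2 →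
        ∃ Bhat : PMF B,
          (∀ a ∈ A, p - ε ≤ QuantumMinMax.expectation Bhat (QuantumMinMax.payoff f a)) ∧
          ∃ (S : Multiset B) (hS : S ≠ 0),
            Bhat = PMF.ofMultiset S hS ∧ (S.card : ℝ) ≤ C * (Real.log d / ε ^ 2) := by
  refine ⟨33, by norm_num, fun d hd A hA B _ f hf p hp ε hε hε2 => ?_⟩
  obtain ⟨F, hF, hFA⟩ := QuantumMinMax.exists_mem_convexHull_forall_lt hA f hf hp (half_pos hε)
  have hε2' : 0 < ε ^ 2 := by positivity
  -- `log d / ε ^ 2 ≥ 4 log 2 ≥ 1` absorbs the rounding of the number of samples.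
  have hlog : 1 ≤ Real.log d / ε ^ 2 := by
    have h1 : Real.log 2 ≤ Real.log d :=
      Real.log_le_log (by norm_num) (by exact_mod_cast hd)
    rw [le_div_iff₀ hε2']
    nlinarith [Real.log_two_gt_d9]
  set T := ⌈32 * (Real.log d / ε ^ 2)⌉₊ with hT
  have hT1 : 32 * (Real.log d / ε ^ 2) ≤ T := Nat.le_ceil _
  have hT2 : (T : ℝ) ≤ 33 * (Real.log d / ε ^ 2) := by
    have := Nat.ceil_lt_add_one (show 0 ≤ 32 * (Real.log d / ε ^ 2) by linarith)
    linarith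
  have hT0 : (0 : ℝ) < T := by linarith
  obtain ⟨S, hS, hSa⟩ := QuantumMinMax.exists_multiset_average_le (by omega) hf hF
    (η := ε / 8) (by linarith) (by linarith) T
  have hS0 : S ≠ 0 := by
    rintro rfl
    simp [← hS] at hT0
  refine ⟨PMF.ofMultiset S hS0, fun a ha => ?_, S, hS0, rfl, by rwa [hS]⟩
  rw [QuantumMinMax.expectation_ofMultiset, hS, le_div_iff₀ hT0]
  have h1 := hSa a (hA ha)
  have h2 := mul_lt_mul_of_pos_left (hFA a ha) hT0
  have h3 : Real.log d ≤ ε / 8 * (ε / 4 * T) := by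
    have : 32 * Real.log d ≤ T * ε ^ 2 := by
      rwa [← mul_div_assoc, div_le_iff₀ hε2'] at hT1
    linarith
  have h4 : Real.log d + T * (2 * (ε / 8) ^ 2) ≤ ε / 8 * (ε / 2 * T) := by linarith
  have h5 := le_of_mul_le_mul_left (h1.trans h4) (by linarith)
  linarith
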